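/- Let $Q_1=\chi_{[-1/2,1/2]}$ and $Q_{m+1}=Q_m*Q_1$ for $m\ge 1$ (the B-splines). For $\phi\in L^2(\mathbb{R})$ and $\alpha,\beta>0$, the Gabor system $\mathcal{G}(\phi,\alpha,\beta)=\{e^{2\pi i\beta n\,\cdot}\phi(\cdot-\alpha k):k,n\in\mathbb{Z}\}$ is a frame for $L^2(\mathbb{R})$ if there are constants $A,B>0$ with $$A\|f\|^2\le\sum_{k,n\in\mathbb{Z}}\bigl|\langle f,e^{2\pi i\beta n\,\cdot}\phi(\cdot-\alpha k)\rangle\bigr|^2\le B\|f\|^2\quad\text{for all } f\in L^2(\mathbb{R}).$$ Theorem. Let $m\ge 2$ be an integer. For all $\alpha,\beta>0$ with $\alpha\beta<1$ there exists a $\gamma>0$, whose ratio $\gamma/\beta$ depends only on $m$ and the product $\alpha\beta$, such that $\mathcal{G}(Q_m(\gamma\,\cdot),\alpha,\beta)$ is a frame for $L^2(\mathbb{R})$. -/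

import Mathlib

open MeasureTheory

noncomputable section

namespace Gabor

/-- The centred cardinal B-spline `Q m` of order `m ≥ 1`: `Q 1` is the characteristic function of
`[-1/2, 1/2]`, and `Q (m + 1)` is the convolution `Q m * Q 1`. The value at order `0` is a
placeholder without meaning. -/
def Q : ℕ → ℝ → ℝ
  | 0 => 0
  | 1 => Set.indicator (Set.Icc (-(1 / 2)) (1 / 2)) 1
  | m + 2 => convolution (Q (m + 1)) (Q 1) (ContinuousLinearMap.mul ℝ ℝ) volume

/-- A family of vectors `e` in a complex inner product space is a frame when there are constants
`A, B > 0` with `A ‖f‖ ^ 2 ≤ ∑ |⟨f, e i⟩| ^ 2 ≤ B ‖f‖ ^ 2` for all `f` (the sum being convergent).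
Mathlib's inner product is linear in the second argument. -/
def IsFrame {ι E : Type*} [NormedAddCommGroup E] [InnerProductSpace ℂ E] (e : ι → E) : Prop :=
  ∃ A B : ℝ, 0 < A ∧ 0 < B ∧ ∀ f : E,
    Summable (fun i => ‖inner ℂ (e i) f‖ ^ 2) ∧
    A * ‖f‖ ^ 2 ≤ ∑' i, ‖inner ℂ (e i) f‖ ^ 2 ∧
    ∑' i, ‖inner ℂ (e i) f‖ ^ 2 ≤ B * ‖f‖ ^ 2

/-- The time-frequency shift `x ↦ exp (2 π i β n x) φ (x - α k)`, where `p = (k, n)`. -/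
def atom (φ : ℝ → ℂ) (α β : ℝ) (p : ℤ × ℤ) (x : ℝ) : ℂ :=
  Complex.exp (2 * Real.pi * Complex.I * β * p.2 * x) * φ (x - α * p.1)

theorem memLp_atom {φ : ℝ → ℂ} (hφ : MemLp φ 2 volume) (α β : ℝ) (p : ℤ × ℤ) :
    MemLp (atom φ α β p) 2 volume := by
  have h1 : MemLp (fun x => φ (x - α * p.1)) 2 volume :=
    hφ.comp_measurePreserving (measurePreserving_sub_right volume (α * p.1))
  have hc : Continuous fun x : ℝ => Complex.exp (2 * Real.pi * Complex.I * β * p.2 * x) := by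
    fun_prop
  refine h1.of_le (hc.aestronglyMeasurable.mul h1.aestronglyMeasurable)
    (Filter.Eventually.of_forall fun x => ?_)
  have h2 : (2 * Real.pi * Complex.I * β * p.2 * x : ℂ)
      = ((2 * Real.pi * β * p.2 * x : ℝ) : ℂ) * Complex.I := by
    push_cast
    ring
  rw [atom, norm_mul, h2, Complex.norm_exp_ofReal_mul_I, one_mul]

/-- `𝒢(φ, α, β)`, the system of all time-frequency shifts of `φ` along `α ℤ × β ℤ`, is a frame for
the Hilbert space `L²(ℝ)` of complex-valued functions. The window has to lie in `L²(ℝ)`. -/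
def IsGaborFrame (φ : ℝ → ℂ) (α β : ℝ) : Prop :=
  ∃ hφ : MemLp φ 2 (volume : Measure ℝ),
    IsFrame (E := Lp ℂ 2 (volume : Measure ℝ))
      (fun p : ℤ × ℤ => (memLp_atom hφ α β p).toLp (atom φ α β p))

end Gabor

end

/-!
The idea is to choose the dilation so that the window is compactly supported on an interval of
length exactly `1 / β`. Then the modulations `exp (2 π i β n x)` restricted to that interval form an
orthogonal basis, and Parseval's identity gives, for each translate,
`∑ n, |⟨f, E_{βn} T_{αk} φ⟩| ^ 2 = (1 / β) ∫ |f x| ^ 2 |φ (x - α k)| ^ 2`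
(`Gabor.hasSum_sq_integral_exp_mul`, `Gabor.hasSum_sq_inner_atom`). Summing over `k`, the system is a
frame as soon as `∑ k, |φ (x - α k)| ^ 2` is bounded above and below. The upper bound holds because
at each `x` only boundedly many translates are nonzero; for the lower bound it suffices that `|φ|` is
bounded below on `[-α / 2, α / 2]`, since the translates of this interval cover the line
(`Gabor.isGaborFrame_of_support`; this is the painless nonorthogonal expansion of
Daubechies, Grossmann and Meyer).

The spline `Q m` is continuous for `m ≥ 2`, vanishes outside `[-m / 2, m / 2]` and is positive on
`(-m / 2, m / 2)`. With `γ = β m` the window `Q m (γ x)` therefore lives on `[-1 / (2 β), 1 / (2 β)]`,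
and `α β < 1` says precisely that `[-α / 2, α / 2]` is a compact subset of the interior of that
interval, where the window is positive. So `γ / β = m`.
-/

open MeasureTheory Set

namespace Gabor

/-! ### Elementary properties of the B-splines -/

theorem Q_one : Q 1 = (Icc (-(1 / 2) : ℝ) (1 / 2)).indicator 1 := by
  rw [Q]

/-- The recursion of the B-splines as a moving average of width `1`. -/
theorem Q_add_two_apply (m : ℕ) (x : ℝ) :
    Q (m + 2) x = ∫ t in (x - 1 / 2)..(x + 1 / 2), Q (m + 1) t := by
  have h : ∀ t, Q (m + 1) t * Q 1 (x - t)
      = (Icc (x - 1 / 2) (x + 1 / 2)).indicator (Q (m + 1)) t := by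
    intro t
    have hiff : x - t ∈ Icc (-(1 / 2) : ℝ) (1 / 2) ↔ t ∈ Icc (x - 1 / 2) (x + 1 / 2) := by
      simp only [mem_Icc]
      constructor <;> rintro ⟨h1, h2⟩ <;> constructor <;> linarith
    by_cases ht : t ∈ Icc (x - 1 / 2) (x + 1 / 2)
    · rw [indicator_of_mem ht, Q_one, indicator_of_mem (hiff.2 ht), Pi.one_apply, mul_one]
    · rw [indicator_of_notMem ht, Q_one, indicator_of_notMem (fun h' => ht (hiff.1 h')), mul_zero]
  calc Q (m + 2) x = ∫ t, Q (m + 1) t * Q 1 (x - t) := by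
        conv_lhs => rw [Q]
        rfl
    _ = ∫ t in Icc (x - 1 / 2) (x + 1 / 2), Q (m + 1) t := by
        simp_rw [h]
        exact integral_indicator measurableSet_Icc
    _ = _ := by
        rw [integral_Icc_eq_integral_Ioc, intervalIntegral.integral_of_le (by linarith)]

theorem continuous_moving_average {g : ℝ → ℝ} (hg : ∀ a b, IntervalIntegrable g volume a b) :
    Continuous fun x : ℝ => ∫ t in (x - 1 / 2)..(x + 1 / 2), g t := by
  have h0 := intervalIntegral.continuous_primitive hg 0
  have h : (fun x : ℝ => ∫ t in (x - 1 / 2)..(x + 1 / 2), g t)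
      = fun x : ℝ => (∫ t in (0 : ℝ)..(x + 1 / 2), g t) - ∫ t in (0 : ℝ)..(x - 1 / 2), g t := by
    ext x
    rw [intervalIntegral.integral_interval_sub_left (hg _ _) (hg _ _)]
  rw [h]
  exact (h0.comp (by fun_prop)).sub (h0.comp (by fun_prop))

theorem intervalIntegrable_Q (m : ℕ) (a b : ℝ) :
    IntervalIntegrable (Q (m + 1)) volume a b := by
  induction m generalizing a b with
  | zero =>
    refine Integrable.intervalIntegrable ?_
    rw [zero_add, Q_one, integrable_indicator_iff measurableSet_Icc]
    exact integrableOn_const isCompact_Icc.measure_lt_top.ne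
  | succ m ih =>
    have h := continuous_moving_average ih
    simp_rw [← Q_add_two_apply] at h
    exact h.intervalIntegrable a b

theorem continuous_Q {m : ℕ} (hm : 2 ≤ m) : Continuous (Q m) := by
  obtain ⟨m, rfl⟩ := Nat.exists_eq_add_of_le' hm
  have h := continuous_moving_average (intervalIntegrable_Q m)
  simpa only [← Q_add_two_apply] using h

theorem Q_nonneg (m : ℕ) (x : ℝ) : 0 ≤ Q (m + 1) x := by
  induction m generalizing x with
  | zero =>
    rw [zero_add, Q_one]
    exact indicator_nonneg (fun _ _ => zero_le_one) x
  | succ m ih =>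
    rw [Q_add_two_apply]
    exact intervalIntegral.integral_nonneg (by linarith) fun t _ => ih t

theorem Q_eq_zero (m : ℕ) (x : ℝ) (hx : ((m + 1 : ℕ) : ℝ) / 2 < |x|) : Q (m + 1) x = 0 := by
  induction m generalizing x with
  | zero =>
    rw [zero_add, Q_one]
    refine indicator_of_notMem (fun h => ?_) _
    have := abs_le.2 h
    norm_num at hx this
    linarith
  | succ m ih =>
    rw [Q_add_two_apply]
    refine intervalIntegral.integral_zero_ae (Filter.Eventually.of_forall fun t ht => ih t ?_)
    rw [uIoc_of_le (by linarith), mem_Ioc] at ht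
    push_cast at hx ⊢
    have : |x - t| ≤ 1 / 2 := abs_le.2 ⟨by linarith, by linarith⟩
    have := abs_sub_abs_le_abs_sub x t
    linarith

theorem Q_pos (m : ℕ) (x : ℝ) (hx : |x| < ((m + 1 : ℕ) : ℝ) / 2) : 0 < Q (m + 1) x := by
  induction m generalizing x with
  | zero =>
    have h : x ∈ Icc (-(1 / 2) : ℝ) (1 / 2) := by
      norm_num at hx
      exact abs_le.1 (by linarith)
    rw [zero_add, Q_one, indicator_of_mem h]
    exact one_pos
  | succ m ih =>
    rw [Q_add_two_apply, intervalIntegral.integral_of_le (by linarith),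
      setIntegral_pos_iff_support_of_nonneg_ae (Filter.Eventually.of_forall fun t => Q_nonneg m t)
        (intervalIntegrable_Q m _ _).1]
    -- the averaging window meets the interval where the previous spline is positive
    have hsub : Ioo (max (x - 1 / 2) (-(((m + 1 : ℕ) : ℝ) / 2)))
        (min (x + 1 / 2) (((m + 1 : ℕ) : ℝ) / 2)) ⊆
          Function.support (Q (m + 1)) ∩ Ioc (x - 1 / 2) (x + 1 / 2) := by
      rintro t ⟨h1, h2⟩
      rw [max_lt_iff] at h1
      rw [lt_min_iff] at h2
      exact ⟨(ih t (abs_lt.2 ⟨h1.2, h2.2⟩)).ne', h1.1, h2.1.le⟩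
    refine lt_of_lt_of_le ?_ (measure_mono hsub)
    rw [Real.volume_Ioo, ENNReal.ofReal_pos, sub_pos, max_lt_iff, lt_min_iff, lt_min_iff]
    have := abs_lt.1 hx
    push_cast at this ⊢
    have hm : (0 : ℝ) ≤ m := m.cast_nonneg
    exact ⟨⟨by linarith, by linarith⟩, ⟨by linarith, by linarith⟩⟩

/-! ### Parseval's identity for the modulations of a function supported on one period -/

/-- Parseval on an interval of length `1 / β`, for functions on the line vanishing outside it. -/
theorem hasSum_sq_integral_exp_mul {g : ℝ → ℂ} (hg : MemLp g 2 volume) {a b β : ℝ} (hβ : 0 < β)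
    (hab : b - a = β⁻¹) (hsupp : ∀ x ∉ Icc a b, g x = 0) :
    HasSum (fun n : ℤ => ‖∫ x : ℝ, Complex.exp (2 * Real.pi * Complex.I * β * (-n : ℤ) * x) * g x‖ ^ 2)
      (β⁻¹ * ∫ x, ‖g x‖ ^ 2) := by
  have hlt : a < b := by
    have := inv_pos.2 hβ
    linarith
  have hint : ∀ {E : Type} [NormedAddCommGroup E] [NormedSpace ℝ E] (h : ℝ → E),
      (∀ x ∉ Icc a b, h x = 0) → ∫ x in a..b, h x = ∫ x, h x := by
    intro E _ _ h hh
    rw [intervalIntegral.integral_of_le hlt.le, ← integral_Icc_eq_integral_Ioc,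
      setIntegral_eq_integral_of_forall_compl_eq_zero hh]
  have key := (hasSum_sq_fourierCoeffOn hlt (hg.mono_measure Measure.restrict_le_self)).mul_left
    (β⁻¹ ^ 2)
  rw [hint _ (fun x hx => by rw [hsupp x hx]; simp), hab, inv_inv, smul_eq_mul] at key
  have hval : β⁻¹ ^ 2 * (β * ∫ x, ‖g x‖ ^ 2) = β⁻¹ * ∫ x, ‖g x‖ ^ 2 := by
    field_simp
  rw [hval] at key
  refine key.congr_fun fun n => ?_
  rw [fourierCoeffOn_eq_integral, hint _ (fun x hx => by rw [hsupp x hx, smul_zero]), hab,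
    norm_smul, mul_pow, one_div, inv_inv, Real.norm_of_nonneg hβ.le, ← mul_assoc, ← mul_pow,
    inv_mul_cancel₀ hβ.ne', one_pow, one_mul]
  congr 3
  ext x
  rw [fourier_coe_apply, smul_eq_mul]
  congr 2
  push_cast
  field_simp

/-! ### Gabor systems with a window supported on one period of the modulations -/

theorem norm_sq_eq_integral (f : Lp ℂ 2 (volume : Measure ℝ)) : ‖f‖ ^ 2 = ∫ x, ‖f x‖ ^ 2 := by
  have h : (inner ℂ f f : ℂ) = ((‖f‖ ^ 2 : ℝ) : ℂ) := by
    rw [inner_self_eq_norm_sq_to_K]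
    norm_cast
  rw [L2.inner_def] at h
  simp_rw [inner_self_eq_norm_sq_to_K] at h
  have h' : ∫ x, ((‖f x‖ ^ 2 : ℝ) : ℂ) = ((‖f‖ ^ 2 : ℝ) : ℂ) := by
    rw [← h]
    simp
  rw [integral_complex_ofReal] at h'
  exact_mod_cast h'.symm

theorem integrable_norm_sq (f : Lp ℂ 2 (volume : Measure ℝ)) :
    Integrable fun x => ‖f x‖ ^ 2 :=
  (memLp_two_iff_integrable_sq_norm (Lp.memLp f).1).1 (Lp.memLp f)

variable {φ : ℝ → ℂ} {α β C : ℝ}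

/-- The function `f · conj (φ (· - α k))`, whose Fourier coefficients are the frame coefficients of
`f` with translation index `k`. -/
def localized (φ : ℝ → ℂ) (α : ℝ) (f : ℝ → ℂ) (k : ℤ) (x : ℝ) : ℂ :=
  starRingEnd ℂ (φ (x - α * k)) * f x

theorem norm_localized_sq (f : ℝ → ℂ) (k : ℤ) (x : ℝ) :
    ‖localized φ α f k x‖ ^ 2 = ‖φ (x - α * k)‖ ^ 2 * ‖f x‖ ^ 2 := by
  rw [localized, norm_mul, RCLike.norm_conj, mul_pow]

theorem memLp_localized (hφ : MemLp φ 2 volume) (hC : ∀ x, ‖φ x‖ ≤ C)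
    (f : Lp ℂ 2 (volume : Measure ℝ)) (k : ℤ) : MemLp (localized φ α f k) 2 volume := by
  have h1 : MemLp (fun x => φ (x - α * k)) 2 volume :=
    hφ.comp_measurePreserving (measurePreserving_sub_right volume (α * k))
  refine (Lp.memLp f).of_le_mul (c := C)
    ((Complex.continuous_conj.comp_aestronglyMeasurable h1.1).mul (Lp.memLp f).1)
    (Filter.Eventually.of_forall fun x => ?_)
  rw [localized, norm_mul, RCLike.norm_conj]
  exact mul_le_mul_of_nonneg_right (hC _) (norm_nonneg _)

theorem inner_atom (hφ : MemLp φ 2 volume) (f : Lp ℂ 2 (volume : Measure ℝ)) (k n : ℤ) :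
    inner ℂ ((memLp_atom hφ α β (k, n)).toLp (atom φ α β (k, n))) f
      = ∫ x : ℝ, Complex.exp (2 * Real.pi * Complex.I * β * (-n : ℤ) * x) * localized φ α f k x := by
  rw [L2.inner_def]
  refine integral_congr_ae ?_
  filter_upwards [(memLp_atom hφ α β (k, n)).coeFn_toLp] with x hx
  rw [hx, RCLike.inner_apply, atom, localized, map_mul, ← Complex.exp_conj]
  simp only [map_mul, Complex.conj_ofReal, Complex.conj_I, map_ofNat, map_intCast, Int.cast_neg,
    mul_neg, neg_mul]
  ring

theorem hasSum_sq_inner_atom (hβ : 0 < β) (hφ : MemLp φ 2 volume) (hC : ∀ x, ‖φ x‖ ≤ C)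
    (hsupp : ∀ x, β⁻¹ / 2 < |x| → φ x = 0) (f : Lp ℂ 2 (volume : Measure ℝ)) (k : ℤ) :
    HasSum (fun n : ℤ =>
      ‖inner ℂ ((memLp_atom hφ α β (k, n)).toLp (atom φ α β (k, n))) f‖ ^ 2)
      (β⁻¹ * ∫ x, ‖localized φ α f k x‖ ^ 2) := by
  simp_rw [inner_atom hφ]
  refine hasSum_sq_integral_exp_mul (a := α * k - β⁻¹ / 2) (b := α * k + β⁻¹ / 2)
    (memLp_localized hφ hC f k) hβ (by ring) fun x hx => ?_
  rw [localized, hsupp, map_zero, zero_mul]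
  by_contra h
  rw [not_lt, abs_le] at h
  exact hx ⟨by linarith, by linarith⟩

/-- At most `r / α + 1` of the points `x - α k` lie in an interval of length `r`. -/
theorem sum_norm_sq_translates_le (hα : 0 < α) {r : ℝ} (hr : 0 ≤ r) (hC : ∀ x, ‖φ x‖ ≤ C)
    (hsupp : ∀ x, r / 2 < |x| → φ x = 0) (s : Finset ℤ) (x : ℝ) :
    ∑ k ∈ s, ‖φ (x - α * k)‖ ^ 2 ≤ (r / α + 1) * C ^ 2 := by
  set t := Finset.Icc ⌈(x - r / 2) / α⌉ ⌊(x + r / 2) / α⌋ with ht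
  have hcard : (t.card : ℝ) ≤ r / α + 1 := by
    rw [ht, Int.card_Icc]
    have h : ((⌊(x + r / 2) / α⌋ + 1 - ⌈(x - r / 2) / α⌉ : ℤ) : ℝ) ≤ r / α + 1 := by
      have h1 := Int.floor_le ((x + r / 2) / α)
      have h2 := Int.le_ceil ((x - r / 2) / α)
      have h3 : (x + r / 2) / α - (x - r / 2) / α = r / α := by ring
      push_cast
      linarith
    have h0 : 0 ≤ r / α + 1 := by positivity
    have h' : (((⌊(x + r / 2) / α⌋ + 1 - ⌈(x - r / 2) / α⌉).toNat : ℤ) : ℝ) ≤ r / α + 1 := by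
      rw [Int.toNat_eq_max]
      push_cast
      push_cast at h
      exact max_le h h0
    exact_mod_cast h'
  have hzero : ∀ k ∉ t, ‖φ (x - α * k)‖ ^ 2 = 0 := by
    intro k hk
    rw [hsupp, norm_zero, zero_pow two_ne_zero]
    by_contra h
    rw [not_lt, abs_le] at h
    refine hk (Finset.mem_Icc.2 ⟨Int.ceil_le.2 ?_, Int.le_floor.2 ?_⟩)
    · rw [div_le_iff₀ hα]
      linarith
    · rw [le_div_iff₀ hα]
      linarith
  calc ∑ k ∈ s, ‖φ (x - α * k)‖ ^ 2
      ≤ ∑ k ∈ s ∪ t, ‖φ (x - α * k)‖ ^ 2 :=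
        Finset.sum_le_sum_of_subset_of_nonneg Finset.subset_union_left fun _ _ _ => by positivity
    _ = ∑ k ∈ t, ‖φ (x - α * k)‖ ^ 2 :=
        (Finset.sum_subset Finset.subset_union_right fun k _ hk => hzero k hk).symm
    _ ≤ t.card • C ^ 2 :=
        Finset.sum_le_card_nsmul _ _ _ fun k _ => pow_le_pow_left₀ (norm_nonneg _) (hC _) 2
    _ ≤ (r / α + 1) * C ^ 2 := by
        rw [nsmul_eq_mul]
        exact mul_le_mul_of_nonneg_right hcard (sq_nonneg C)

/-- Painless nonorthogonal expansions: a bounded window supported on an interval of length `1 / β`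
and bounded away from zero on a fundamental domain of `α ℤ` generates a Gabor frame. -/
theorem isGaborFrame_of_support (hα : 0 < α) (hβ : 0 < β) (hφ : MemLp φ 2 volume)
    (hC0 : 0 < C) (hC : ∀ x, ‖φ x‖ ≤ C) (hsupp : ∀ x, β⁻¹ / 2 < |x| → φ x = 0) {c : ℝ} (hc0 : 0 < c)
    (hc : ∀ x, |x| ≤ α / 2 → c ≤ ‖φ x‖) : IsGaborFrame φ α β := by
  have hβ' : 0 < β⁻¹ := inv_pos.2 hβ
  refine ⟨hφ, β⁻¹ * c ^ 2, β⁻¹ * ((β⁻¹ / α + 1) * C ^ 2), by positivity, by positivity,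
    fun f => ?_⟩
  have hrow := hasSum_sq_inner_atom (α := α) hβ hφ hC hsupp f
  have hf := integrable_norm_sq f
  have hloc : ∀ k, Integrable fun x => ‖localized φ α f k x‖ ^ 2 := fun k =>
    (memLp_two_iff_integrable_sq_norm (memLp_localized hφ hC f k).1).1 (memLp_localized hφ hC f k)
  have hnn : ∀ k, 0 ≤ β⁻¹ * ∫ x, ‖localized φ α f k x‖ ^ 2 := fun k =>
    mul_nonneg hβ'.le (integral_nonneg fun x => by positivity)
  have hupper : ∀ s : Finset ℤ, ∑ k ∈ s, β⁻¹ * ∫ x, ‖localized φ α f k x‖ ^ 2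
      ≤ β⁻¹ * ((β⁻¹ / α + 1) * C ^ 2) * ‖f‖ ^ 2 := by
    intro s
    rw [← Finset.mul_sum, ← integral_finsetSum s fun k _ => hloc k, mul_assoc,
      norm_sq_eq_integral, ← integral_const_mul (_ * C ^ 2)]
    refine mul_le_mul_of_nonneg_left (integral_mono (integrable_finsetSum s fun k _ => hloc k)
      (hf.const_mul _) fun x => ?_) hβ'.le
    simp_rw [norm_localized_sq]
    rw [← Finset.sum_mul]
    exact mul_le_mul_of_nonneg_right (sum_norm_sq_translates_le hα hβ'.le hC hsupp s x)
      (by positivity)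
  have hsum : Summable fun k => β⁻¹ * ∫ x, ‖localized φ α f k x‖ ^ 2 :=
    summable_of_sum_le hnn hupper
  have hprod : Summable fun p : ℤ × ℤ =>
      ‖inner ℂ ((memLp_atom hφ α β p).toLp (atom φ α β p)) f‖ ^ 2 := by
    refine (summable_prod_of_nonneg fun p => by positivity).2 ⟨fun k => (hrow k).summable, ?_⟩
    simpa only [(hrow _).tsum_eq] using hsum
  have htsum : ∑' p : ℤ × ℤ, ‖inner ℂ ((memLp_atom hφ α β p).toLp (atom φ α β p)) f‖ ^ 2
      = ∑' k : ℤ, β⁻¹ * ∫ x, ‖localized φ α f k x‖ ^ 2 := by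
    rw [hprod.tsum_prod' fun k => (hrow k).summable]
    exact tsum_congr fun k => (hrow k).tsum_eq
  refine ⟨hprod, ?_, ?_⟩
  · -- split `‖f‖ ^ 2` over the translates by `α k` of the fundamental domain `(-α / 2, α / 2]`
    have hcell := hasSum_integral_iUnion (μ := volume) (f := fun x => ‖f x‖ ^ 2)
      (fun n : ℤ => measurableSet_Ioc) (pairwise_disjoint_Ioc_add_zsmul (-(α / 2)) α)
      hf.integrableOn
    rw [iUnion_Ioc_add_zsmul hα, setIntegral_univ, ← norm_sq_eq_integral] at hcell
    rw [htsum]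
    refine hasSum_le (fun k => ?_) (hcell.mul_left (β⁻¹ * c ^ 2)) hsum.hasSum
    rw [mul_assoc, ← integral_const_mul]
    refine mul_le_mul_of_nonneg_left ?_ hβ'.le
    refine (setIntegral_mono_on (hf.const_mul _).integrableOn (hloc k).integrableOn
      measurableSet_Ioc fun x hx => ?_).trans
      (setIntegral_le_integral (hloc k) (Filter.Eventually.of_forall fun x => by positivity))
    rw [norm_localized_sq]
    simp only [zsmul_eq_mul, mem_Ioc, Int.cast_add, Int.cast_one] at hx
    exact mul_le_mul_of_nonneg_right (pow_le_pow_left₀ hc0.le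
      (hc _ (abs_le.2 ⟨by linarith, by linarith⟩)) 2) (by positivity)
  · rw [htsum]
    exact hsum.tsum_le_of_sum_le hupper

end Gabor

open Gabor in
theorem theorem3p3 (m : ℕ) (hm : 2 ≤ m) :
    ∃ ρ : ℝ → ℝ, ∀ α β : ℝ, 0 < α → 0 < β → α * β < 1 →
      ∃ γ : ℝ, 0 < γ ∧ γ = β * ρ (α * β) ∧
        Gabor.IsGaborFrame (fun x : ℝ => (Gabor.Q m (γ * x) : ℂ)) α β := by
  refine ⟨fun _ => m, fun α β hα hβ hαβ => ⟨β * m, by positivity, rfl, ?_⟩⟩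
  have hm0 : (0 : ℝ) < m := by positivity
  have hQ := continuous_Q hm
  obtain ⟨j, rfl⟩ : ∃ j, m = j + 1 := ⟨m - 1, by omega⟩
  have hcont : Continuous fun x : ℝ => (Q (j + 1) (β * (j + 1 : ℕ) * x) : ℂ) := by fun_prop
  have habs : ∀ x : ℝ, |β * (j + 1 : ℕ) * x| = β * (j + 1 : ℕ) * |x| := fun x => by
    rw [abs_mul, abs_of_pos (by positivity)]
  have hsupp : ∀ x : ℝ, β⁻¹ / 2 < |x| → (Q (j + 1) (β * (j + 1 : ℕ) * x) : ℂ) = 0 := by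
    intro x hx
    rw [Q_eq_zero, Complex.ofReal_zero]
    rw [habs]
    have := mul_lt_mul_of_pos_left hx (mul_pos hβ hm0)
    field_simp at this ⊢
    linarith
  have hcpt : HasCompactSupport fun x : ℝ => (Q (j + 1) (β * (j + 1 : ℕ) * x) : ℂ) := by
    refine HasCompactSupport.intro (isCompact_Icc (a := -(β⁻¹ / 2)) (b := β⁻¹ / 2))
      fun x hx => hsupp x ?_
    by_contra h
    exact hx (abs_le.1 (not_lt.1 h))
  obtain ⟨C, hC⟩ := hcont.bounded_above_of_compact_support hcpt
  obtain ⟨x₀, hx₀, hmin⟩ := (isCompact_Icc (a := -(α / 2)) (b := α / 2)).exists_isMinOn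
    ⟨0, by constructor <;> linarith⟩ hcont.norm.continuousOn
  refine isGaborFrame_of_support (C := max C 1) hα hβ (hcont.memLp_of_hasCompactSupport hcpt)
    (by positivity) (fun x => (hC x).trans (le_max_left _ _)) hsupp ?_
    fun x hx => hmin (abs_le.1 hx)
  rw [norm_pos_iff, Complex.ofReal_ne_zero]
  refine (Q_pos j _ ?_).ne'
  rw [habs]
  have h := abs_le.2 hx₀
  have : β * |x₀| < 1 / 2 := by nlinarith
  nlinarith
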